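/- Fix variables $p_0,p_1,\ldots$. For a finite set $\mathrm A$ of unary modalities $\Diamond$ (an alphabet), modal formulas over $\mathrm A$ are built from the variables by Boolean connectives and the modalities in $\mathrm A$; $\Box\varphi$ is $\neg\Diamond\neg\varphi$. A \emph{logic over $\mathrm A$} is a set of formulas over $\mathrm A$ that contains all classical tautologies and the formulas $\neg\Diamond\bot$, $\Diamond(p_0\vee p_1)\to\Diamond p_0\vee\Diamond p_1$ ($\Diamond\in\mathrm A$), and is closed under modus ponens, substitution and monotonicity (from $\varphi\to\psi$ infer $\Diamond\varphi\to\Diamond\psi$). An \emph{extension} of $L_0$ is a logic $L\supseteq L_0$ over the same alphabet. A logic $L$ is \emph{locally tabular} if for each $k<\omega$ there are, up to $L$-equivalence, only finitely many formulas in the variables $p_0,\ldots,p_{k-1}$. For $\mathrm C\subseteq\mathrm A$, $L^{\restriction\mathrm C}$ is the set of formulas over $\mathrm C$ that are in $L$. The \emph{canonical frame} of $L$ is the Kripke frame (possibly empty) of all maximal $L$-consistent sets of formulas, where $\Gamma R_\Diamond\Delta$ iff $\Diamond\varphi\in\Gamma$ for all $\varphi\in\Delta$; $L$ is \emph{canonical}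 if all formulas of $L$ are valid in its canonical frame. Let $\Diamond_{\mathrm A}\varphi=\bigvee_{\Diamond\in\mathrm A}\Diamond\varphi$ (which is $\bot$ if $\mathrm A=\varnothing$), and let $\Diamond_{\mathrm A}^{\le m}\varphi=\bigvee_{i\le m}\Diamond_{\mathrm A}^{i}\varphi$, where $\Diamond_{\mathrm A}^{0}\varphi=\varphi$ and $\Diamond_{\mathrm A}^{i+1}\varphi=\Diamond_{\mathrm A}\Diamond_{\mathrm A}^{i}\varphi$. Let $B_0=\bot$ and $B_h=p_h\to\Box(\Diamond p_h\vee B_{h-1})$ for $h\ge1$. If $L$ is a logic over $\mathrm A$ that contains $\Diamond_{\mathrm A}^{m+1}p_0\to\Diamond_{\mathrm A}^{\le m}p_0$ for some $m<\omega$, take the least such $m$; the \emph{height} of $L$ is the least $h<\omega$ such that $L$ contains the formula obtained from $B_h$ by replacing $\Diamond$ with $\Diamond_{\mathrm A}^{\le m}$, and $\omega$ if there is no such $h$. If there is no such $m$, the height of $L$ is $\omega$. A logic $L_0$ over $\mathrm A$ \emph{admits the finite height criterion} if for every extension $L$ of $L_0$: $L$ is locally tabular if and only if the height of $L^{\restriction\mathrm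 C}$ is finite for every $\mathrm C\subseteq\mathrm A$. \textbf{Theorem.} Let $\mathrm A$ and $\mathrm B$ be disjoint finite alphabets, and let $L_1$ and $L_2$ be canonical logics over $\mathrm A$ and $\mathrm B$, respectively, that both admit the finite height criterion. Let $L_1\oplus L_2$ be the smallest logic over $\mathrm A\cup\mathrm B$ that contains $L_1$, $L_2$ and, for all $\Diamond_v\in\mathrm A$ and $\Diamond_h\in\mathrm B$, the formulas $$\Diamond_h\Diamond_v p_0\to\Diamond_v p_0,\qquad \Diamond_v\Diamond_h p_0\to\Diamond_v p_0,\qquad \Diamond_v p_0\to\Box_h\Diamond_v p_0 .$$ Then $L_1\oplus L_2$ admits the finite height criterion. -/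

import Mathlib

namespace Modal

universe u v w

/-- Modal formulas over the alphabet of modalities `A`, with variables `p₀, p₁, …`.
The remaining Boolean connectives are abbreviations. -/
inductive Formula (A : Type u) : Type u
  | var : ℕ → Formula A
  | bot : Formula A
  | imp : Formula A → Formula A → Formula A
  | dia : A → Formula A → Formula A

namespace Formula

variable {A : Type u} {B : Type v}

def neg (φ : Formula A) : Formula A := imp φ bot

def top : Formula A := neg bot

def or (φ ψ : Formula A) : Formula A := imp (neg φ) ψ

def and (φ ψ : Formula A) : Formula A := neg (imp φ (neg ψ))

def iff (φ ψ : Formula A) : Formula A := and (imp φ ψ) (imp ψ φ)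

def box (a : A) (φ : Formula A) : Formula A := neg (dia a (neg φ))

/-- Disjunction of a finite list; the empty disjunction is `⊥`. -/
def disj (l : List (Formula A)) : Formula A := l.foldr or bot

/-- Conjunction of a finite list; the empty conjunction is `⊤`. -/
def conj (l : List (Formula A)) : Formula A := l.foldr and top

/-- Simultaneous substitution of formulas for variables. -/
def subst (s : ℕ → Formula A) : Formula A → Formula A
  | var i => s i
  | bot => bot
  | imp φ ψ => imp (subst s φ) (subst s ψ)
  | dia a φ => dia a (subst s φ)

/-- Renaming of modalities along `f : A → B`. For an injective `f` this is the usual reading of a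
formula over a smaller alphabet as a formula over a larger one. -/
def map (f : A → B) : Formula A → Formula B
  | var i => var i
  | bot => bot
  | imp φ ψ => imp (map f φ) (map f ψ)
  | dia a φ => dia (f a) (map f φ)

/-- `φ` is a `k`-formula: all its variables are among `p_i`, `i < k`. -/
def IsKFormula (k : ℕ) : Formula A → Prop
  | var i => i < k
  | bot => True
  | imp φ ψ => IsKFormula k φ ∧ IsKFormula k ψ
  | dia _ φ => IsKFormula k φ

/-- Boolean truth value of a formula, given truth values of its variables and of its
subformulas of the form `◇φ`. -/
def boolEval (e : Formula A → Prop) : Formula A → Prop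
  | var i => e (var i)
  | bot => False
  | imp φ ψ => boolEval e φ → boolEval e ψ
  | dia a φ => e (dia a φ)

/-- Classical tautologies (in the modal language). -/
def IsTautology (φ : Formula A) : Prop := ∀ e : Formula A → Prop, boolEval e φ

/-- `◇_A φ`, the disjunction of all `◇φ` with `◇` in the finite alphabet `A`. -/
noncomputable def diaAll [Finite A] (φ : Formula A) : Formula A :=
  disj ((@Finset.univ A (Fintype.ofFinite A)).toList.map fun a => dia a φ)

/-- `◇_A^i φ`. -/
noncomputable def diaIter [Finite A] : ℕ → Formula A → Formula A
  | 0, φ => φ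
  | i + 1, φ => diaAll (diaIter i φ)

/-- `◇_A^{≤ m} φ`, the disjunction of `◇_A^i φ` over `i ≤ m`. -/
noncomputable def diaLE [Finite A] (m : ℕ) (φ : Formula A) : Formula A :=
  disj ((List.range (m + 1)).map fun i => diaIter i φ)

/-- The formula of `m`-transitivity `◇_A^{m+1} p → ◇_A^{≤ m} p`. -/
noncomputable def trans (A : Type u) [Finite A] (m : ℕ) : Formula A :=
  imp (diaIter (m + 1) (var 0)) (diaLE m (var 0))

/-- The unimodal formulas of finite height: `B_0 = ⊥`, `B_h = p_h → □(◇p_h ∨ B_{h-1})`. -/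
def heightFormula : ℕ → Formula Unit
  | 0 => bot
  | h + 1 => imp (var (h + 1)) (box () (or (dia () (var (h + 1))) (heightFormula h)))

/-- Replace each occurrence of `◇` in a unimodal formula by `◇_A^{≤ m}`. -/
noncomputable def star [Finite A] (m : ℕ) : Formula Unit → Formula A
  | var i => var i
  | bot => bot
  | imp φ ψ => imp (star m φ) (star m ψ)
  | dia _ φ => diaLE m (star m φ)

end Formula

open Formula

/-- Normal modal logics over the alphabet `A`. -/
structure IsLogic {A : Type u} (L : Set (Formula A)) : Prop where
  tautology : ∀ φ, φ.IsTautology → φ ∈ L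
  dia_bot : ∀ a, neg (dia a bot) ∈ L
  dia_or : ∀ a, imp (dia a (or (var 0) (var 1))) (or (dia a (var 0)) (dia a (var 1))) ∈ L
  modus_ponens : ∀ φ ψ, imp φ ψ ∈ L → φ ∈ L → ψ ∈ L
  substitution : ∀ (s : ℕ → Formula A) φ, φ ∈ L → φ.subst s ∈ L
  monotonicity : ∀ a φ ψ, imp φ ψ ∈ L → imp (dia a φ) (dia a ψ) ∈ L

/-- The smallest logic containing a set of formulas. -/
def smallestLogic {A : Type u} (S : Set (Formula A)) : Set (Formula A) :=
  ⋂₀ {L | IsLogic L ∧ S ⊆ L}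

theorem isLogic_smallestLogic {A : Type u} (S : Set (Formula A)) :
    IsLogic (smallestLogic S) where
  tautology φ h L hL := hL.1.tautology φ h
  dia_bot a L hL := hL.1.dia_bot a
  dia_or a L hL := hL.1.dia_or a
  modus_ponens φ ψ h₁ h₂ L hL := hL.1.modus_ponens φ ψ (h₁ L hL) (h₂ L hL)
  substitution s φ h L hL := hL.1.substitution s φ (h L hL)
  monotonicity a φ ψ h L hL := hL.1.monotonicity a φ ψ (h L hL)

/-- The restriction of `L` to the alphabet `C ⊆ A`: all formulas over `C` that are in `L`. -/
def fragment {A : Type u} (L : Set (Formula A)) (C : Set A) : Set (Formula C) :=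
  {φ | φ.map (Subtype.val : C → A) ∈ L}

/-- The universe of the Lindenbaum algebra of `L` over `k` variables: the set of classes of
`L`-equivalent `k`-formulas. -/
def lindenbaum {A : Type u} (L : Set (Formula A)) (k : ℕ) : Set (Set (Formula A)) :=
  (fun φ => {ψ | ψ.IsKFormula k ∧ iff φ ψ ∈ L}) '' {φ | φ.IsKFormula k}

/-- Up to `L`-equivalence, there are only finitely many `k`-formulas. -/
def KFinite {A : Type u} (L : Set (Formula A)) (k : ℕ) : Prop := (lindenbaum L k).Finite

def LocallyTabular {A : Type u} (L : Set (Formula A)) : Prop := ∀ k : ℕ, KFinite L k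

/-- The least `m` such that `L` contains the `m`-transitivity formula, or `⊤` if there is none. -/
noncomputable def transIndex {A : Type u} [Finite A] (L : Set (Formula A)) : ℕ∞ :=
  sInf {n | ∃ m : ℕ, n = m ∧ Formula.trans A m ∈ L}

/-- For a pretransitive `L` with transitivity index `m`, the least `h` such that `L` contains
`B_h` with `◇` replaced by `◇_A^{≤ m}`, or `⊤` if there is none;
`⊤` also if `L` is not pretransitive. -/
noncomputable def height {A : Type u} [Finite A] (L : Set (Formula A)) : ℕ∞ :=
  sInf {n | ∃ m h : ℕ, transIndex L = m ∧ n = h ∧ star m (heightFormula h) ∈ L}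

/-- `L₀` admits the finite height criterion: an extension of `L₀` (over the same alphabet) is
locally tabular iff its restrictions to all subalphabets have finite height. -/
def AdmitsFiniteHeightCriterion {A : Type u} [Finite A] (L₀ : Set (Formula A)) : Prop :=
  ∀ L : Set (Formula A), IsLogic L → L₀ ⊆ L →
    (LocallyTabular L ↔ ∀ C : Set A, height (fragment L C) < ⊤)

/-- Kripke frames over the alphabet `A`; the domain `X` may be empty. -/
structure Frame (A : Type u) (X : Type w) where
  rel : A → X → X → Prop

/-- Truth of a formula at a point of the Kripke model `(F, θ)`. -/
def Frame.Sat {A : Type u} {X : Type w} (F : Frame A X) (θ : ℕ → Set X) :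
    X → Formula A → Prop
  | x, .var i => x ∈ θ i
  | _, .bot => False
  | x, .imp φ ψ => F.Sat θ x φ → F.Sat θ x ψ
  | x, .dia a φ => ∃ y, F.rel a x y ∧ F.Sat θ y φ

/-- Validity of a formula in a Kripke frame. -/
def Frame.Valid {A : Type u} {X : Type w} (F : Frame A X) (φ : Formula A) : Prop :=
  ∀ (θ : ℕ → Set X) (x : X), F.Sat θ x φ

/-- `Γ` is `L`-consistent: no finite conjunction of elements of `Γ` is refutable in `L`. -/
def Consistent {A : Type u} (L Γ : Set (Formula A)) : Prop :=
  ∀ l : List (Formula A), (∀ φ ∈ l, φ ∈ Γ) → neg (conj l) ∉ L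

/-- Maximal `L`-consistent sets of formulas, that is, ultrafilters of the Lindenbaum algebra
of `L` over countably many variables. -/
abbrev MaxConsistent {A : Type u} (L : Set (Formula A)) : Type u :=
  {Γ : Set (Formula A) // Maximal (Consistent L) Γ}

/-- The canonical frame of `L`. -/
def canonicalFrame {A : Type u} (L : Set (Formula A)) : Frame A (MaxConsistent L) where
  rel a Γ Δ := ∀ φ, φ ∈ Δ.1 → dia a φ ∈ Γ.1

/-- `L` is canonical: it is valid in its canonical frame. -/
def Canonical {A : Type u} (L : Set (Formula A)) : Prop :=
  ∀ φ ∈ L, (canonicalFrame L).Valid φ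

/-- The axioms `Φ(A, B)` of lexicographic sums, for vertical modalities `a` in `A` and horizontal
modalities `b` in `B`. The union of the disjoint alphabets is the sum type `A ⊕ B`. -/
def lexAxioms (A : Type u) (B : Type v) : Set (Formula (A ⊕ B)) :=
  {φ | ∃ (a : A) (b : B),
    φ = imp (dia (.inr b) (dia (.inl a) (var 0))) (dia (.inl a) (var 0)) ∨
    φ = imp (dia (.inl a) (dia (.inr b) (var 0))) (dia (.inl a) (var 0)) ∨
    φ = imp (dia (.inl a) (var 0)) (box (.inr b) (dia (.inl a) (var 0)))}

/-- `L₁ ⊕ L₂`: the smallest logic over `A ⊕ B` that contains `L₁`, `L₂` and `Φ(A, B)`. -/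
def lexSum {A : Type u} {B : Type v} (L₁ : Set (Formula A)) (L₂ : Set (Formula B)) :
    Set (Formula (A ⊕ B)) :=
  smallestLogic (Formula.map Sum.inl '' L₁ ∪ Formula.map Sum.inr '' L₂ ∪ lexAxioms A B)

end Modal

/-! Let $L$ extend $L_1\oplus L_2$. One direction holds for every logic: local tabularity passes to
fragments, and a locally tabular logic has finite height (`LocallyTabular.height_lt_top`). Among the
one-variable formulas $\Diamond^{\le n}p_0$ two are equivalent, which yields pretransitivity. Among
the formulas "the truth value of $p_0$ alternates $n$ times along a chain" two are equivalent as
well. A refutation of $B_{N+1}$ would give a formula that alternates $N$ times along some chain but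
never more often, so some $B_{N+1}$ belongs to the logic.

Conversely, if all fragments of $L$ have finite height, the two criteria make the vertical and the
horizontal fragment locally tabular, and `locallyTabular_of_lexAxioms` combines them. Horizontally
related points satisfy the same formulas $\Diamond_v\varphi$. Substitute the finitely many
horizontal $k$-formulas into vertical formulas. The resulting finite algebra is already closed under
$\Diamond_h$: whether $\Diamond_h\varphi$ holds at $x$ depends only on the horizontal types seen
from $x$ and on the vertical diamonds true at $x$, which all horizontal successors share.

Formulas are handled through their truth sets in a model that characterizes the logic
(`IsLogic.exists_characterizes`). Its frame need not validate the logic, so axioms are applied to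
definable sets only. -/

namespace Modal

universe u v w

open Formula

/-! ### Kripke semantics of the defined connectives -/

namespace Frame

variable {A : Type u} {X : Type w} (F : Frame A X) (θ : ℕ → Set X) (x : X)

@[simp] theorem sat_var (i : ℕ) : F.Sat θ x (.var i) ↔ x ∈ θ i := Iff.rfl

@[simp] theorem sat_bot : ¬ F.Sat θ x .bot := fun h => h

@[simp] theorem sat_imp (φ ψ : Formula A) :
    F.Sat θ x (.imp φ ψ) ↔ (F.Sat θ x φ → F.Sat θ x ψ) := Iff.rfl

@[simp] theorem sat_dia (a : A) (φ : Formula A) :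
    F.Sat θ x (.dia a φ) ↔ ∃ y, F.rel a x y ∧ F.Sat θ y φ := Iff.rfl

@[simp] theorem sat_neg (φ : Formula A) : F.Sat θ x (neg φ) ↔ ¬ F.Sat θ x φ := Iff.rfl

@[simp] theorem sat_top : F.Sat θ x top := fun h => h

@[simp] theorem sat_or (φ ψ : Formula A) :
    F.Sat θ x (or φ ψ) ↔ F.Sat θ x φ ∨ F.Sat θ x ψ := by
  simp only [Formula.or, sat_imp, sat_neg]; tauto

@[simp] theorem sat_and (φ ψ : Formula A) :
    F.Sat θ x (and φ ψ) ↔ F.Sat θ x φ ∧ F.Sat θ x ψ := by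
  simp only [Formula.and, sat_imp, sat_neg]; tauto

@[simp] theorem sat_iff (φ ψ : Formula A) :
    F.Sat θ x (iff φ ψ) ↔ (F.Sat θ x φ ↔ F.Sat θ x ψ) := by
  simp only [iff, sat_and, sat_imp]; tauto

@[simp] theorem sat_box (a : A) (φ : Formula A) :
    F.Sat θ x (box a φ) ↔ ∀ y, F.rel a x y → F.Sat θ y φ := by
  simp only [box, sat_neg, sat_dia]; push Not; rfl

theorem sat_disj (l : List (Formula A)) :
    F.Sat θ x (disj l) ↔ ∃ φ ∈ l, F.Sat θ x φ := by
  induction l with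
  | nil => simp [disj]
  | cons a l ih =>
    have : disj (a :: l) = or a (disj l) := rfl
    simp [this, ih]

theorem sat_conj (l : List (Formula A)) :
    F.Sat θ x (conj l) ↔ ∀ φ ∈ l, F.Sat θ x φ := by
  induction l with
  | nil => simp [conj]
  | cons a l ih =>
    have : conj (a :: l) = and a (conj l) := rfl
    simp [this, ih]

/-- The union of all the relations of a frame. -/
def step (x y : X) : Prop := ∃ a, F.rel a x y

/-- `y` is reachable from `x` in exactly `n` steps. -/
def stepN : ℕ → X → X → Prop
  | 0, x, y => x = y
  | n + 1, x, y => ∃ z, F.step x z ∧ stepN n z y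

/-- `y` is reachable from `x` in at most `m` steps. -/
def stepLE (m : ℕ) (x y : X) : Prop := ∃ n ≤ m, F.stepN n x y

theorem stepLE_refl (m : ℕ) (x : X) : F.stepLE m x x := ⟨0, Nat.zero_le _, rfl⟩

theorem stepN_add {F : Frame A X} {n k : ℕ} {x y z : X} (h : F.stepN n x y) (h' : F.stepN k y z) :
    F.stepN (n + k) x z := by
  induction n generalizing x with
  | zero => rw [Nat.zero_add]; exact h ▸ h'
  | succ n ih =>
    obtain ⟨t, ht, hty⟩ := h
    rw [Nat.add_right_comm]
    exact ⟨t, ht, ih hty⟩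

variable [Finite A]

@[simp] theorem sat_diaAll (φ : Formula A) :
    F.Sat θ x (diaAll φ) ↔ ∃ y, F.step x y ∧ F.Sat θ y φ := by
  simp only [diaAll, sat_disj, List.mem_map, Finset.mem_toList, Finset.mem_univ, true_and, step]
  constructor
  · rintro ⟨_, ⟨a, rfl⟩, y, h, h'⟩
    exact ⟨y, ⟨a, h⟩, h'⟩
  · rintro ⟨y, ⟨a, h⟩, h'⟩
    exact ⟨_, ⟨a, rfl⟩, y, h, h'⟩

@[simp] theorem sat_diaIter (n : ℕ) (φ : Formula A) :
    F.Sat θ x (diaIter n φ) ↔ ∃ y, F.stepN n x y ∧ F.Sat θ y φ := by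
  induction n generalizing x with
  | zero => simp [diaIter, stepN]
  | succ n ih =>
    simp only [diaIter, sat_diaAll, ih, stepN]
    constructor
    · rintro ⟨z, hz, y, hy, h⟩
      exact ⟨y, ⟨z, hz, hy⟩, h⟩
    · rintro ⟨y, ⟨z, hz, hy⟩, h⟩
      exact ⟨z, hz, y, hy, h⟩

@[simp] theorem sat_diaLE (m : ℕ) (φ : Formula A) :
    F.Sat θ x (diaLE m φ) ↔ ∃ y, F.stepLE m x y ∧ F.Sat θ y φ := by
  simp only [diaLE, sat_disj, List.mem_map, List.mem_range, Nat.lt_succ_iff, stepLE]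
  constructor
  · rintro ⟨_, ⟨n, hn, rfl⟩, h⟩
    obtain ⟨y, hy, h⟩ := (F.sat_diaIter θ x n φ).1 h
    exact ⟨y, ⟨n, hn, hy⟩, h⟩
  · rintro ⟨y, ⟨n, hn, hy⟩, h⟩
    exact ⟨_, ⟨n, hn, rfl⟩, (F.sat_diaIter θ x n φ).2 ⟨y, hy, h⟩⟩

end Frame

/-- The reduct of a frame along a map of alphabets. -/
def Frame.comap {A : Type u} {B : Type v} {X : Type w} (f : A → B) (F : Frame B X) :
    Frame A X where
  rel a := F.rel (f a)

theorem Frame.sat_map {A : Type u} {B : Type v} {X : Type w} (f : A → B) (F : Frame B X)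
    (θ : ℕ → Set X) (x : X) (φ : Formula A) :
    F.Sat θ x (φ.map f) ↔ (F.comap f).Sat θ x φ := by
  induction φ generalizing x with
  | var i => rfl
  | bot => rfl
  | imp φ ψ h₁ h₂ => simp only [Formula.map, sat_imp, h₁, h₂]
  | dia a φ h => simp only [Formula.map, sat_dia, h]; rfl

/-! ### Syntactic operations -/

namespace Formula

variable {A : Type u} {B : Type v}

theorem map_subst (f : A → B) (s : ℕ → Formula A) (φ : Formula A) :
    (φ.subst s).map f = (φ.map f).subst fun i => (s i).map f := by
  induction φ with
  | var i => rfl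
  | bot => rfl
  | imp φ ψ h₁ h₂ => simp [subst, map, h₁, h₂]
  | dia a φ h => simp [subst, map, h]

theorem boolEval_map (f : A → B) (e : Formula B → Prop) (φ : Formula A) :
    boolEval e (φ.map f) ↔ boolEval (fun ψ => e (ψ.map f)) φ := by
  induction φ with
  | var i => rfl
  | bot => rfl
  | imp φ ψ h₁ h₂ => simp only [boolEval, map, h₁, h₂]
  | dia a φ h => rfl

theorem isKFormula_map (f : A → B) {k : ℕ} {φ : Formula A} (h : φ.IsKFormula k) :
    (φ.map f).IsKFormula k := by
  induction φ with
  | var i => exact h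
  | bot => trivial
  | imp φ ψ h₁ h₂ => exact ⟨h₁ h.1, h₂ h.2⟩
  | dia a φ ih => exact ih h

theorem subst_disj (s : ℕ → Formula A) (l : List (Formula A)) :
    (disj l).subst s = disj (l.map (subst s)) := by
  induction l with
  | nil => rfl
  | cons a l ih =>
    change or (a.subst s) ((disj l).subst s) = or _ _
    rw [ih]; rfl

theorem isKFormula_disj {k : ℕ} {l : List (Formula A)} (h : ∀ φ ∈ l, φ.IsKFormula k) :
    (disj l).IsKFormula k := by
  induction l with
  | nil => trivial
  | cons a l ih =>
    exact ⟨⟨h a (by simp), trivial⟩, ih fun φ hφ => h φ (by simp [hφ])⟩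

variable [Finite A]

theorem subst_diaIter (s : ℕ → Formula A) (n : ℕ) (φ : Formula A) :
    (diaIter n φ).subst s = diaIter n (φ.subst s) := by
  induction n with
  | zero => rfl
  | succ n ih =>
    simp only [diaIter, diaAll, subst_disj, List.map_map, ← ih]
    rfl

theorem subst_diaLE (s : ℕ → Formula A) (m : ℕ) (φ : Formula A) :
    (diaLE m φ).subst s = diaLE m (φ.subst s) := by
  simp only [diaLE, subst_disj, List.map_map, ← subst_diaIter]
  rfl

theorem isKFormula_diaIter {k : ℕ} {φ : Formula A} (h : φ.IsKFormula k) (n : ℕ) :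
    (diaIter n φ).IsKFormula k := by
  induction n with
  | zero => exact h
  | succ n ih =>
    refine isKFormula_disj fun ψ hψ => ?_
    obtain ⟨a, -, rfl⟩ := List.mem_map.1 hψ
    exact ih

theorem isKFormula_diaLE {k : ℕ} {φ : Formula A} (h : φ.IsKFormula k) (m : ℕ) :
    (diaLE m φ).IsKFormula k := by
  refine isKFormula_disj fun ψ hψ => ?_
  obtain ⟨n, -, rfl⟩ := List.mem_map.1 hψ
  exact isKFormula_diaIter h n

end Formula

/-- The formulas that a renaming of modalities sends into `L`. -/
def pullback {A : Type u} {B : Type v} (f : A → B) (L : Set (Formula B)) : Set (Formula A) :=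
  {φ | φ.map f ∈ L}

theorem IsLogic.pullback {A : Type u} {B : Type v} (f : A → B) {L : Set (Formula B)}
    (hL : IsLogic L) : IsLogic (pullback f L) where
  tautology φ h := hL.tautology _ fun e => (boolEval_map f e φ).2 (h _)
  dia_bot a := hL.dia_bot (f a)
  dia_or a := hL.dia_or (f a)
  modus_ponens φ ψ h₁ h₂ := hL.modus_ponens _ _ h₁ h₂
  substitution s φ h := by
    have := hL.substitution (fun i => (s i).map f) _ h
    rwa [← map_subst] at this
  monotonicity a φ ψ h := hL.monotonicity (f a) _ _ h

/-! ### The canonical model -/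

section Canonical

variable {A : Type u} {L : Set (Formula A)}

/-- `T` contains `L` and is closed under modus ponens. -/
structure IsTheory (L T : Set (Formula A)) : Prop where
  subset : L ⊆ T
  modus_ponens : ∀ φ ψ, imp φ ψ ∈ T → φ ∈ T → ψ ∈ T

/-- Complete consistent theories. -/
structure IsComplete (L T : Set (Formula A)) : Prop extends IsTheory L T where
  bot_notMem : bot ∉ T
  mem_or_neg_mem : ∀ φ, φ ∈ T ∨ neg φ ∈ T

namespace IsTheory

variable {T : Set (Formula A)} {φ ψ χ : Formula A}

theorem mem_of_tautology (hL : IsLogic L) (hT : IsTheory L T) (h : φ.IsTautology) : φ ∈ T :=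
  hT.subset (hL.tautology _ h)

/-- Tautological consequence from two premises. -/
theorem mem₂ (hL : IsLogic L) (hT : IsTheory L T) (h₁ : φ ∈ T) (h₂ : ψ ∈ T)
    (h : (imp φ (imp ψ χ)).IsTautology) : χ ∈ T :=
  hT.modus_ponens _ _ (hT.modus_ponens _ _ (hT.mem_of_tautology hL h) h₁) h₂

theorem adjoin (hL : IsLogic L) (hT : IsTheory L T) (φ : Formula A) :
    IsTheory L {ψ | imp φ ψ ∈ T} where
  subset ψ h := by
    change imp φ ψ ∈ T
    exact hT.mem₂ hL (hT.subset h) (hT.subset h) fun e => by simp only [boolEval]; tauto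
  modus_ponens ψ χ h₁ h₂ := by
    change imp φ χ ∈ T
    exact hT.mem₂ hL h₁ h₂ fun e => by simp only [boolEval]; tauto

/-- Lindenbaum's lemma. -/
theorem exists_isComplete (hL : IsLogic L) (hT : IsTheory L T) (hφ : φ ∉ T) :
    ∃ U, T ⊆ U ∧ IsComplete L U ∧ φ ∉ U := by
  obtain ⟨U, hTU, hU⟩ := zorn_subset_nonempty {U | IsTheory L U ∧ φ ∉ U} (by
    intro c hc hchain hne
    refine ⟨⋃₀ c, ⟨⟨?_, ?_⟩, ?_⟩, fun s hs => Set.subset_sUnion_of_mem hs⟩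
    · obtain ⟨s, hs⟩ := hne
      exact (hc hs).1.subset.trans (Set.subset_sUnion_of_mem hs)
    · rintro ψ χ ⟨s, hs, h₁⟩ ⟨t, ht, h₂⟩
      rcases hchain.total hs ht with h | h
      · exact ⟨t, ht, (hc ht).1.modus_ponens _ _ (h h₁) h₂⟩
      · exact ⟨s, hs, (hc hs).1.modus_ponens _ _ h₁ (h h₂)⟩
    · rintro ⟨s, hs, h⟩
      exact (hc hs).2 h) T ⟨hT, hφ⟩
  have hUT := hU.prop.1
  -- Otherwise the theory `{χ | imp ψ χ ∈ U}` omits `φ` and contains both `U` and `ψ`, against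
  -- maximality.
  have key : ∀ ψ, ψ ∉ U → imp ψ φ ∈ U := by
    intro ψ hψ
    by_contra h
    refine hψ (hU.le_of_ge (y := {χ | imp ψ χ ∈ U}) ⟨hUT.adjoin hL ψ, h⟩ ?_ ?_)
    · intro χ hχ
      change imp ψ χ ∈ U
      exact hUT.mem₂ hL hχ hχ fun e => by simp only [boolEval]; tauto
    · change imp ψ ψ ∈ U
      exact hUT.mem_of_tautology hL fun e => by simp only [boolEval]; tauto
  refine ⟨U, hTU, ⟨hUT, fun h => hU.prop.2 ?_, fun ψ => ?_⟩, hU.prop.2⟩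
  · exact hUT.mem₂ hL h h fun e => by simp only [boolEval]; tauto
  · by_contra! h
    refine hU.prop.2 (hUT.mem₂ hL (key _ h.1) (key _ h.2) fun e => ?_)
    simp only [boolEval, neg]; tauto

end IsTheory

theorem IsComplete.neg_mem_iff {T : Set (Formula A)} (hT : IsComplete L T) {φ : Formula A} :
    neg φ ∈ T ↔ φ ∉ T :=
  ⟨fun h h' => hT.bot_notMem (hT.modus_ponens _ _ h h'), (hT.mem_or_neg_mem φ).resolve_left⟩

theorem IsComplete.imp_mem_iff (hL : IsLogic L) {T : Set (Formula A)} (hT : IsComplete L T)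
    {φ ψ : Formula A} : imp φ ψ ∈ T ↔ (φ ∈ T → ψ ∈ T) := by
  refine ⟨hT.modus_ponens _ _, fun h => ?_⟩
  by_cases hφ : φ ∈ T
  · exact hT.mem₂ hL (h hφ) (h hφ) fun e => by simp only [boolEval]; tauto
  · have := hT.neg_mem_iff.2 hφ
    exact hT.mem₂ hL this this fun e => by simp only [boolEval, neg]; tauto

theorem IsTheory.dia_mono {T : Set (Formula A)} (hL : IsLogic L) (hT : IsTheory L T) {a : A}
    {φ ψ : Formula A} (h : imp φ ψ ∈ L) (h' : dia a φ ∈ T) : dia a ψ ∈ T :=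
  hT.modus_ponens _ _ (hT.subset (hL.monotonicity a _ _ h)) h'

theorem IsComplete.dia_or {T : Set (Formula A)} (hL : IsLogic L) (hT : IsComplete L T) {a : A}
    {φ ψ : Formula A} (h : dia a (or φ ψ) ∈ T) : dia a φ ∈ T ∨ dia a ψ ∈ T := by
  have := hL.substitution (fun i => if i = 0 then φ else ψ) _ (hL.dia_or a)
  simp only [subst, Formula.or, neg, if_true, one_ne_zero, if_false] at this
  by_contra! hne
  exact hne.2 (hT.modus_ponens _ _ (hT.modus_ponens _ _ (hT.subset this) h)
    (hT.neg_mem_iff.2 hne.1))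

/-- The formulas `ψ` with `dia a (and φ (neg ψ)) ∉ T` form a theory that contains `φ` and, because
`dia a φ ∈ T`, omits `⊥`. Any complete `U` above it is a successor of `T`: if `dia a ψ ∉ T`, then
`neg ψ` is in this theory. -/
theorem IsComplete.exists_of_dia_mem {T : Set (Formula A)} (hL : IsLogic L) (hT : IsComplete L T)
    {a : A} {φ : Formula A} (h : dia a φ ∈ T) :
    ∃ U, IsComplete L U ∧ (∀ ψ ∈ U, dia a ψ ∈ T) ∧ φ ∈ U := by
  have hS : IsTheory L {ψ | dia a (and φ (neg ψ)) ∉ T} := by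
    refine ⟨fun ψ hψ hmem => ?_, fun ψ χ h₁ h₂ hmem => ?_⟩
    · refine hT.neg_mem_iff.1 (hT.subset (hL.dia_bot a)) (hT.dia_mono hL ?_ hmem)
      refine hL.modus_ponens _ _ (hL.tautology _ fun e => ?_) hψ
      simp only [boolEval, Formula.and, neg]; tauto
    · have : dia a (or (and φ (neg ψ)) (and φ (neg (imp ψ χ)))) ∈ T := by
        refine hT.dia_mono hL (hL.tautology _ fun e => ?_) hmem
        simp only [boolEval, Formula.and, neg, Formula.or]; tauto
      exact (hT.dia_or hL this).elim h₂ h₁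
  obtain ⟨U, hSU, hU, -⟩ := hS.exists_isComplete hL (φ := bot) fun hmem => hmem (by
    refine hT.dia_mono hL (hL.tautology _ fun e => ?_) h
    simp only [boolEval, Formula.and, neg]; tauto)
  refine ⟨U, hU, fun ψ hψ => ?_, hSU fun hmem => ?_⟩
  · by_contra hne
    have : neg ψ ∈ U := hSU fun hmem => hne (by
      refine hT.dia_mono hL (hL.tautology _ fun e => ?_) hmem
      simp only [boolEval, Formula.and, neg]; tauto)
    exact hU.neg_mem_iff.1 this hψ
  · refine hT.neg_mem_iff.1 (hT.subset (hL.dia_bot a)) (hT.dia_mono hL ?_ hmem)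
    refine hL.tautology _ fun e => ?_
    simp only [boolEval, Formula.and, neg]; tauto

/-- `L` is the set of formulas true at all points of the model `(F, θ)`. -/
def Characterizes {X : Type w} (F : Frame A X) (θ : ℕ → Set X) (L : Set (Formula A)) : Prop :=
  ∀ φ, φ ∈ L ↔ ∀ x, F.Sat θ x φ

/-- Every logic is characterized by its canonical model. -/
theorem IsLogic.exists_characterizes (hL : IsLogic L) :
    ∃ (X : Type u) (F : Frame A X) (θ : ℕ → Set X), Characterizes F θ L := by
  let F : Frame A {T : Set (Formula A) // IsComplete L T} :=
    ⟨fun a T U => ∀ φ, φ ∈ U.1 → dia a φ ∈ T.1⟩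
  let θ : ℕ → Set {T : Set (Formula A) // IsComplete L T} := fun i => {T | var i ∈ T.1}
  have truth : ∀ φ T, F.Sat θ T φ ↔ φ ∈ T.1 := by
    intro φ
    induction φ with
    | var i => exact fun T => Iff.rfl
    | bot => exact fun T => iff_of_false (F.sat_bot θ T) T.2.bot_notMem
    | imp φ ψ h₁ h₂ => exact fun T => by rw [F.sat_imp, h₁, h₂, T.2.imp_mem_iff hL]
    | dia a φ ih =>
      intro T
      simp only [F.sat_dia, ih]
      constructor
      · rintro ⟨U, hTU, hU⟩
        exact hTU φ hU
      · intro h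
        obtain ⟨U, hU, hTU, hφ⟩ := T.2.exists_of_dia_mem hL h
        exact ⟨⟨U, hU⟩, hTU, hφ⟩
  refine ⟨_, F, θ, fun φ => ⟨fun h T => (truth φ T).2 (T.2.subset h), fun h => ?_⟩⟩
  by_contra hφ
  obtain ⟨U, -, hU, hne⟩ :=
    IsTheory.exists_isComplete hL (⟨subset_rfl, hL.modus_ponens⟩ : IsTheory L L) hφ
  exact hne ((truth φ ⟨U, hU⟩).1 (h _))

end Canonical

/-! ### Counting formulas by their truth sets in a characterizing model -/

section Characterizes

variable {A : Type u} {B : Type v} {X : Type w}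

theorem Characterizes.pullback (f : A → B) {F : Frame B X} {θ : ℕ → Set X} {L : Set (Formula B)}
    (h : Characterizes F θ L) : Characterizes (F.comap f) θ (pullback f L) := fun φ => by
  simp only [← Frame.sat_map]
  exact h _

theorem finite_image_of_imp {α β γ : Type*} {f : α → β} {g : α → γ} {S : Set α}
    (hf : (f '' S).Finite) (h : ∀ x ∈ S, ∀ y ∈ S, f x = f y → g x = g y) :
    (g '' S).Finite := by
  rcases S.eq_empty_or_nonempty with rfl | ⟨x₀, -⟩
  · simp
  have : Nonempty α := ⟨x₀⟩
  refine (hf.image (g ∘ Function.invFunOn f S)).subset ?_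
  rintro _ ⟨x, hx, rfl⟩
  have hmem : f x ∈ f '' S := ⟨x, hx, rfl⟩
  exact ⟨f x, hmem, h _ (Function.invFunOn_mem hmem) _ hx (Function.invFunOn_eq hmem)⟩

/-- The truth set of a formula in a model. -/
def Frame.truthSet (F : Frame A X) (θ : ℕ → Set X) (φ : Formula A) : Set X := {x | F.Sat θ x φ}

theorem Characterizes.iff_mem {F : Frame A X} {θ : ℕ → Set X} {L : Set (Formula A)}
    (h : Characterizes F θ L) {φ ψ : Formula A} :
    iff φ ψ ∈ L ↔ F.truthSet θ φ = F.truthSet θ ψ := by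
  simp [h _, Frame.truthSet, Set.ext_iff]

/-- On `k`-formulas, the equivalence class and the truth set determine each other. -/
theorem Characterizes.kFinite_iff {F : Frame A X} {θ : ℕ → Set X} {L : Set (Formula A)}
    (h : Characterizes F θ L) (k : ℕ) :
    KFinite L k ↔ (F.truthSet θ '' {φ | φ.IsKFormula k}).Finite := by
  refine ⟨fun hf => finite_image_of_imp hf fun φ _ ψ hψ heq => ?_,
    fun hf => finite_image_of_imp hf fun φ _ ψ _ heq => ?_⟩
  · have : ψ ∈ {χ : Formula A | χ.IsKFormula k ∧ iff φ χ ∈ L} := by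
      rw [heq]; exact ⟨hψ, h.iff_mem.2 rfl⟩
    exact h.iff_mem.1 this.2
  · ext χ
    simp only [Set.mem_ofPred_eq, h.iff_mem, heq]

theorem LocallyTabular.pullback (f : A → B) {L : Set (Formula B)} (hL : IsLogic L)
    (h : LocallyTabular L) : LocallyTabular (pullback f L) := by
  obtain ⟨X, F, θ, hF⟩ := hL.exists_characterizes
  intro k
  refine ((hF.pullback f).kFinite_iff k).2 (((hF.kFinite_iff k).1 (h k)).subset ?_)
  rintro _ ⟨φ, hφ, rfl⟩
  refine ⟨φ.map f, isKFormula_map f hφ, ?_⟩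
  ext x
  exact F.sat_map f θ x φ

end Characterizes

/-! ### Height -/

section Height

variable {A : Type u} {B : Type v}

theorem height_lt_top_iff [Finite A] {L : Set (Formula A)} :
    height L < ⊤ ↔ ∃ m h : ℕ, transIndex L = m ∧ star m (heightFormula h) ∈ L := by
  rw [height, sInf_lt_iff]
  constructor
  · rintro ⟨_, ⟨m, h, hm, -, hh⟩, -⟩
    exact ⟨m, h, hm, hh⟩
  · rintro ⟨m, h, hm, hh⟩
    exact ⟨h, ⟨m, h, hm, rfl, hh⟩, WithTop.coe_lt_top _⟩

variable {X : Type w}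

/-- `diaAll` is a disjunction along an arbitrary enumeration of the alphabet, so formulas over
different alphabets are compared through the union of the relations and not syntactically. -/
theorem Frame.stepN_eq_of_step_eq {F : Frame A X} {G : Frame B X} (h : F.step = G.step) (n : ℕ) :
    F.stepN n = G.stepN n := by
  induction n with
  | zero => rfl
  | succ n ih => ext x y; simp only [stepN, h, ih]

theorem Frame.stepLE_eq_of_step_eq {F : Frame A X} {G : Frame B X} (h : F.step = G.step) (m : ℕ) :
    F.stepLE m = G.stepLE m := by
  ext x y; simp only [stepLE, stepN_eq_of_step_eq h]

theorem Frame.sat_trans_iff_of_step_eq [Finite A] [Finite B] {F : Frame A X} {G : Frame B X}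
    (h : F.step = G.step) (θ : ℕ → Set X) (x : X) (m : ℕ) :
    F.Sat θ x (Formula.trans A m) ↔ G.Sat θ x (Formula.trans B m) := by
  simp only [Formula.trans, sat_imp, sat_diaIter, sat_diaLE, sat_var, stepN_eq_of_step_eq h,
    stepLE_eq_of_step_eq h]

theorem Frame.sat_star_iff_of_step_eq [Finite A] [Finite B] {F : Frame A X} {G : Frame B X}
    (h : F.step = G.step) (θ : ℕ → Set X) (m : ℕ) (φ : Formula Unit) (x : X) :
    F.Sat θ x (star m φ) ↔ G.Sat θ x (star m φ) := by
  induction φ generalizing x with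
  | var i => rfl
  | bot => rfl
  | imp φ ψ h₁ h₂ => simp only [Formula.star, sat_imp, h₁, h₂]
  | dia a φ ih => simp only [Formula.star, sat_diaLE, stepLE_eq_of_step_eq h, ih]

/-- Finiteness of the height depends only on the union of the relations of a model. -/
theorem height_lt_top_of_step_eq [Finite A] [Finite B] {F : Frame A X} {G : Frame B X}
    {θ : ℕ → Set X} {L : Set (Formula A)} {L' : Set (Formula B)} (hF : Characterizes F θ L)
    (hG : Characterizes G θ L') (h : F.step = G.step) (hL : height L < ⊤) : height L' < ⊤ := by
  rw [height_lt_top_iff] at hL ⊢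
  obtain ⟨m, k, hm, hk⟩ := hL
  refine ⟨m, k, ?_, ?_⟩
  · rw [← hm, transIndex, transIndex]
    simp only [hF _, hG _, Frame.sat_trans_iff_of_step_eq h]
  · rw [hG]
    exact fun x => (Frame.sat_star_iff_of_step_eq h θ m _ x).1 ((hF _).1 hk x)

/-- An embedding of alphabets identifies subalphabets with subalphabets. -/
theorem height_fragment_pullback_lt_top {f : A → B} [Finite A] [Finite B]
    {L : Set (Formula B)} (hL : IsLogic L) (C : Set A) (h : height (fragment L (f '' C)) < ⊤) :
    height (fragment (pullback f L) C) < ⊤ := by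
  obtain ⟨X, F, θ, hF⟩ := hL.exists_characterizes
  -- A fragment is a pullback along `Subtype.val`, so one model serves both logics, and its two
  -- reducts have the same union of relations.
  refine height_lt_top_of_step_eq (hF.pullback (Subtype.val : f '' C → B))
    ((hF.pullback f).pullback (Subtype.val : C → A)) ?_ h
  ext x y
  constructor
  · rintro ⟨⟨_, c, hc, rfl⟩, h⟩
    exact ⟨⟨c, hc⟩, h⟩
  · rintro ⟨⟨c, hc⟩, h⟩
    exact ⟨⟨f c, c, hc, rfl⟩, h⟩

end Height

/-! ### Locally tabular logics have finite height -/

section Finite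

variable {A : Type u} {X : Type w} {F : Frame A X} {θ : ℕ → Set X}
  {L : Set (Formula A)}

/-- If the formulas `g n` are `k`-formulas and `L` is locally tabular, two of them are
equivalent. -/
theorem Characterizes.exists_lt_truthSet_eq (hF : Characterizes F θ L) (h : LocallyTabular L)
    {k : ℕ} (g : ℕ → Formula A) (hg : ∀ n, (g n).IsKFormula k) :
    ∃ i j, i < j ∧ F.truthSet θ (g i) = F.truthSet θ (g j) := by
  by_contra! hne
  have hinj : Function.Injective fun n => F.truthSet θ (g n) := by
    intro i j hij
    rcases lt_trichotomy i j with h | h | h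
    · exact absurd hij (hne i j h)
    · exact h
    · exact absurd hij.symm (hne j i h)
  refine Set.infinite_range_of_injective hinj (((hF.kFinite_iff k).1 (h k)).subset ?_)
  rintro _ ⟨n, rfl⟩
  exact ⟨g n, hg n, rfl⟩

variable [Finite A]

/-- If $\Diamond^{\le i}p_0$ and $\Diamond^{\le j}p_0$ are equivalent for some $i<j$, then
$\Diamond^{i+1}p_0$ implies the second, hence the first. -/
theorem LocallyTabular.exists_trans_mem (hL : IsLogic L) (h : LocallyTabular L) :
    ∃ m, Formula.trans A m ∈ L := by
  obtain ⟨X, F, θ, hF⟩ := hL.exists_characterizes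
  obtain ⟨i, j, hij, heq⟩ := hF.exists_lt_truthSet_eq h (k := 1)
    (fun n => diaLE n (var 0)) fun n => isKFormula_diaLE (by exact Nat.one_pos) n
  refine ⟨i, (hF _).2 fun x hx => ?_⟩
  change x ∈ F.truthSet θ _
  rw [heq]
  obtain ⟨y, hy, hy'⟩ := (F.sat_diaIter θ x _ _).1 hx
  exact (F.sat_diaLE θ x _ _).2 ⟨y, ⟨i + 1, hij, hy⟩, hy'⟩

theorem LocallyTabular.exists_transIndex_eq (hL : IsLogic L) (h : LocallyTabular L) :
    ∃ m : ℕ, transIndex L = m ∧ Formula.trans A m ∈ L := by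
  obtain ⟨m, hm⟩ := h.exists_trans_mem hL
  have hne : {n : ℕ∞ | ∃ m : ℕ, n = m ∧ Formula.trans A m ∈ L}.Nonempty := ⟨m, m, rfl, hm⟩
  exact csInf_mem hne

/-- The accessibility relation itself need not be $m$-transitive. The axiom only supplies some
nearby point satisfying the same formula `φ`, possibly different from `y`. -/
theorem Characterizes.exists_stepLE_of_stepN (hL : IsLogic L) (hF : Characterizes F θ L) {m : ℕ}
    (hm : Formula.trans A m ∈ L) {φ : Formula A} {n : ℕ} {x y : X} (h : F.stepN n x y)
    (hy : F.Sat θ y φ) : ∃ z, F.stepLE m x z ∧ F.Sat θ z φ := by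
  induction n generalizing x with
  | zero => exact ⟨y, ⟨0, Nat.zero_le _, h⟩, hy⟩
  | succ n ih =>
    obtain ⟨t, hxt, hty⟩ := h
    obtain ⟨z, ⟨i, hi, htz⟩, hz⟩ := ih hty
    rcases hi.lt_or_eq with hlt | rfl
    · exact ⟨z, ⟨i + 1, hlt, t, hxt, htz⟩, hz⟩
    · have := (hF _).1 (hL.substitution (fun _ => φ) _ hm) x
      simp only [Formula.trans, subst, subst_diaIter, subst_diaLE, Frame.sat_imp,
        Frame.sat_diaIter, Frame.sat_diaLE] at this
      exact this ⟨z, ⟨t, hxt, htz⟩, hz⟩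

theorem Characterizes.exists_stepLE_of_stepLE (hL : IsLogic L) (hF : Characterizes F θ L) {m : ℕ}
    (hm : Formula.trans A m ∈ L) {φ : Formula A} {x y z : X} (h : F.stepLE m x y)
    (h' : F.stepLE m y z) (hz : F.Sat θ z φ) : ∃ t, F.stepLE m x t ∧ F.Sat θ t φ := by
  obtain ⟨n, -, hn⟩ := h
  obtain ⟨k, -, hk⟩ := h'
  exact hF.exists_stepLE_of_stepN hL hm (Frame.stepN_add hn hk) hz

/-- `alternation m χ n` says that there is a `◇^{≤ m}`-chain of `n + 1` points at which the truth
values of `χ` alternate, ending with a point at which `χ` is true. -/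
noncomputable def alternation (m : ℕ) (χ : Formula A) : ℕ → Formula A
  | 0 => χ
  | n + 1 => and (if Even (n + 1) then χ else neg χ) (diaLE m (alternation m χ n))

theorem alternation_subst (m : ℕ) (s : ℕ → Formula A) (χ : Formula A) (n : ℕ) :
    (alternation m χ n).subst s = alternation m (χ.subst s) n := by
  induction n with
  | zero => rfl
  | succ n ih =>
    have hand (φ ψ : Formula A) : (and φ ψ).subst s = and (φ.subst s) (ψ.subst s) := rfl
    simp only [alternation, hand, subst_diaLE, ih]
    split_ifs <;> rfl

theorem isKFormula_alternation (m : ℕ) {χ : Formula A} {k : ℕ} (h : χ.IsKFormula k) (n : ℕ) :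
    (alternation m χ n).IsKFormula k := by
  induction n with
  | zero => exact h
  | succ n ih =>
    refine ⟨⟨?_, isKFormula_diaLE ih m, trivial⟩, trivial⟩
    split_ifs
    exacts [h, ⟨h, trivial⟩]

theorem sat_alternation_succ (m : ℕ) (χ : Formula A) (n : ℕ) (x : X) :
    F.Sat θ x (alternation m χ (n + 1)) ↔ (F.Sat θ x χ ↔ Even (n + 1)) ∧
      ∃ y, F.stepLE m x y ∧ F.Sat θ y (alternation m χ n) := by
  simp only [alternation, Frame.sat_and, Frame.sat_diaLE]
  split_ifs with h <;> simp [h]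

/-- No `p_{k+2}`, `n ≤ k < N`, is true at a point reachable in at most `m` steps. -/
noncomputable def above (m N n : ℕ) : Formula A :=
  conj (((List.range N).filter fun k => n ≤ k).map fun k => neg (diaLE m (var (k + 2))))

theorem sat_above (m N n : ℕ) (x : X) :
    F.Sat θ x (above m N n) ↔ ∀ k, k < N → n ≤ k → ¬ ∃ y, F.stepLE m x y ∧ y ∈ θ (k + 2) := by
  simp only [above, Frame.sat_conj, List.mem_map, List.mem_filter, List.mem_range,
    decide_eq_true_eq, forall_exists_index, and_imp]
  constructor
  · intro h k hk hn
    have := h _ k hk hn rfl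
    rwa [Frame.sat_neg, Frame.sat_diaLE] at this
  · rintro h _ k hk hn rfl
    rw [Frame.sat_neg, Frame.sat_diaLE]
    exact h k hk hn

/-- The least `n` such that `above m N n` is true is even. -/
noncomputable def evenLevel (m N : ℕ) : Formula A :=
  disj (((List.range (N + 1)).filter fun n => Even n).map fun n =>
    and (above m N n) (conj ((List.range n).map fun i => neg (above m N i))))

theorem sat_evenLevel (m N : ℕ) (x : X) :
    F.Sat θ x (evenLevel m N) ↔ ∃ n ≤ N, Even n ∧ F.Sat θ x (above m N n) ∧
      ∀ i < n, ¬ F.Sat θ x (above m N i) := by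
  simp [evenLevel, Frame.sat_conj, Frame.sat_disj, and_assoc]

theorem sat_above_mono {m N n n' : ℕ} (h : n ≤ n') {x : X} (hx : F.Sat θ x (above m N n)) :
    F.Sat θ x (above m N n') := by
  rw [sat_above] at hx ⊢
  exact fun k hk hn => hx k hk (h.trans hn)

/-- Call the least `n` with `above m N n` true at a point its level. The hypotheses say that the
level of `x` is exactly `n`; `hx'` is vacuous for `n = 0`. -/
theorem sat_evenLevel_iff {m N n : ℕ} (hn : n ≤ N) {x : X} (hx : F.Sat θ x (above m N n))
    (hx' : ∀ i, n = i + 1 → ¬ F.Sat θ x (above m N i)) :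
    F.Sat θ x (evenLevel m N) ↔ Even n := by
  have hlt : ∀ i < n, ¬ F.Sat θ x (above m N i) := fun i hi h => by
    obtain ⟨j, rfl⟩ : ∃ j, n = j + 1 := ⟨n - 1, by omega⟩
    exact hx' j rfl (sat_above_mono (Nat.lt_succ_iff.1 hi) h)
  rw [sat_evenLevel]
  constructor
  · rintro ⟨j, -, hj, hxj, hxj'⟩
    rcases lt_trichotomy j n with h | h | h
    · exact absurd hxj (hlt j h)
    · exact h ▸ hj
    · exact absurd hx (hxj' n h)
  · exact fun h => ⟨n, hn, h, hx, hlt⟩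

/-- By $m$-transitivity, levels never increase along `stepLE m`. -/
theorem Characterizes.sat_above_of_stepLE (hL : IsLogic L) (hF : Characterizes F θ L) {m : ℕ}
    (hm : Formula.trans A m ∈ L) {N n : ℕ} {x y : X} (h : F.stepLE m x y)
    (hx : F.Sat θ x (above m N n)) : F.Sat θ y (above m N n) := by
  rw [sat_above] at hx ⊢
  rintro k hk hn ⟨z, hyz, hz⟩
  exact hx k hk hn (hF.exists_stepLE_of_stepLE hL hm (φ := var (k + 2)) h hyz hz)

/-- Each change of the parity of the level costs at least one level, and a chain has to end at an
even level. Hence level at most `n` leaves room for at most `n` alternations. -/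
theorem Characterizes.not_sat_alternation_succ (hL : IsLogic L) (hF : Characterizes F θ L) {m : ℕ}
    (hm : Formula.trans A m ∈ L) {N n : ℕ} (hn : n ≤ N) {x : X}
    (hx : F.Sat θ x (above m N n)) :
    ¬ F.Sat θ x (alternation m (evenLevel m N) (n + 1)) := by
  induction n generalizing x with
  | zero =>
    rw [sat_alternation_succ, sat_evenLevel_iff hn hx (by simp)]
    simp
  | succ n ih =>
    rw [sat_alternation_succ]
    rintro ⟨hev, y, hxy, hy⟩
    have hx' : F.Sat θ x (above m N n) := by
      by_contra hne
      rw [sat_evenLevel_iff hn hx (by rintro i h; obtain rfl := Nat.succ.inj h; exact hne)] at hev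
      grind
    exact ih (by omega) (hF.sat_above_of_stepLE hL hm hxy hx') hy

/-- A refutation of $B_{n+1}$ unfolds into a chain $x_n,\ldots,x_0$ where $p_{i+1}$ holds at $x_i$
but nowhere within `m` steps of $x_{i-1}$. Thus $x_i$ has level exactly $i$, and the parities
alternate. The shift in `var (k + 2)` leaves $p_1$ out, so that $x_0$ has level 0. -/
theorem Characterizes.sat_alternation (hL : IsLogic L) (hF : Characterizes F θ L) {m : ℕ}
    (hm : Formula.trans A m ∈ L) {N n : ℕ} (hn : n ≤ N) {x : X}
    (hx : F.Sat θ x (above m N n)) (hx' : ¬ F.Sat θ x (star m (heightFormula (n + 1)))) :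
    F.Sat θ x (alternation m (evenLevel m N) n) := by
  have hstar (h : ℕ) (x : X) : F.Sat θ x (star m (heightFormula (h + 1))) ↔
      (x ∈ θ (h + 1) → ∀ y, F.stepLE m x y →
        (∃ z, F.stepLE m y z ∧ z ∈ θ (h + 1)) ∨ F.Sat θ y (star m (heightFormula h))) := by
    have : star m (heightFormula (h + 1)) = imp (var (h + 1)) (neg (diaLE m (neg
      (or (diaLE m (var (h + 1))) (star m (heightFormula h)))))) (A := A) := rfl
    rw [this]
    simp only [Frame.sat_imp, Frame.sat_neg, Frame.sat_diaLE, Frame.sat_or, Frame.sat_var]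
    push Not
    rfl
  induction n generalizing x with
  | zero => exact (sat_evenLevel_iff hn hx (by simp)).2 (by simp)
  | succ n ih =>
    rw [hstar] at hx'
    push Not at hx'
    obtain ⟨hp, y, hxy, hyp, hy⟩ := hx'
    rw [sat_alternation_succ]
    refine ⟨sat_evenLevel_iff hn hx ?_, y, hxy, ih (by omega) ?_ hy⟩
    -- The variable `var (n + 2)` holds at `x` itself, so the level of `x` is not below `n + 1`.
    · rintro i h hne
      obtain rfl := Nat.succ.inj h
      exact (sat_above m N n x).1 hne n (by omega) le_rfl ⟨x, F.stepLE_refl m x, hp⟩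
    · have hy' := hF.sat_above_of_stepLE hL hm hxy hx
      rw [sat_above] at hy' ⊢
      intro k hk hnk
      rcases hnk.lt_or_eq with h | rfl
      · exact hy' k hk h
      · rintro ⟨z, hyz, hz⟩
        exact hyp z hyz hz

/-- Every locally tabular logic has finite height. -/
theorem LocallyTabular.height_lt_top (hL : IsLogic L) (h : LocallyTabular L) : height L < ⊤ := by
  obtain ⟨m, hmL, hm⟩ := h.exists_transIndex_eq hL
  obtain ⟨X, F, θ, hF⟩ := hL.exists_characterizes
  obtain ⟨N, j, hNj, heq⟩ := hF.exists_lt_truthSet_eq h (k := 1) (alternation m (var 0))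
    (isKFormula_alternation m (by exact Nat.one_pos))
  refine height_lt_top_iff.2 ⟨m, N + 1, hmL, (hF _).2 fun x => ?_⟩
  -- The two equivalent formulas remain equivalent when `evenLevel m N` is substituted for $p_0$.
  have heq' : F.truthSet θ (alternation m (evenLevel m N) N) =
      F.truthSet θ (alternation m (evenLevel m N) j) := by
    rw [← hF.iff_mem] at heq ⊢
    have := hL.substitution (fun _ => evenLevel m N) _ heq
    have hiff (φ ψ : Formula A) (s : ℕ → Formula A) :
      (iff φ ψ).subst s = iff (φ.subst s) (ψ.subst s) := rfl
    rwa [hiff, alternation_subst, alternation_subst] at this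
  have htop (x : X) : F.Sat θ x (above m N N) := by
    rw [sat_above]; intro k h₁ h₂; omega
  -- Levels are at most `N`, so `N + 1` alternations are impossible; a longer chain has a tail with
  -- exactly `N + 1` of them.
  have hbot : ∀ j, N < j → ∀ x, ¬ F.Sat θ x (alternation m (evenLevel m N) j) := by
    intro j hj
    induction j, hj using Nat.le_induction with
    | base => exact fun x => hF.not_sat_alternation_succ hL hm le_rfl (htop x)
    | succ j hj ih =>
      intro x hx
      obtain ⟨-, y, -, hy⟩ := (sat_alternation_succ m _ j x).1 hx
      exact ih y hy
  by_contra hne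
  have hx : x ∈ F.truthSet θ _ := hF.sat_alternation hL hm le_rfl (htop x) hne
  rw [heq'] at hx
  exact hbot j hNj x hx

end Finite

/-! ### Local tabularity of lexicographic sums -/

theorem sInter_mem_of_finite {X : Type*} {P : Set (Set X)} (huniv : Set.univ ∈ P)
    (hinter : ∀ S ∈ P, ∀ T ∈ P, S ∩ T ∈ P) {c : Set (Set X)} (hc : c.Finite) (hcP : c ⊆ P) :
    ⋂₀ c ∈ P := by
  induction c, hc using Set.Finite.induction_on with
  | empty => simpa using huniv
  | insert _ _ ih =>
    rw [Set.sInter_insert]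
    exact hinter _ (hcP (Set.mem_insert _ _)) _ (ih ((Set.subset_insert _ _).trans hcP))

/-- A set that does not separate points which a finite field of sets `P` does not separate
belongs to `P`. -/
theorem mem_of_saturated {X : Type*} {P : Set (Set X)} (hP : P.Finite) (huniv : Set.univ ∈ P)
    (hcompl : ∀ S ∈ P, Sᶜ ∈ P) (hinter : ∀ S ∈ P, ∀ T ∈ P, S ∩ T ∈ P) {Y : Set X}
    (hY : ∀ x y, (∀ S ∈ P, x ∈ S ↔ y ∈ S) → x ∈ Y → y ∈ Y) : Y ∈ P := by
  have hatom (x : X) : ⋂₀ {S ∈ P | x ∈ S} ∈ P :=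
    sInter_mem_of_finite huniv hinter (hP.subset (Set.sep_subset _ _)) (Set.sep_subset _ _)
  have hsub : (fun x => (⋂₀ {S ∈ P | x ∈ S})ᶜ) '' Y ⊆ P := by
    rintro _ ⟨x, -, rfl⟩
    exact hcompl _ (hatom x)
  -- `Y` is the union of the atoms of its points, written as the complement of a finite intersection
  -- of complements.
  have key := hcompl _ (sInter_mem_of_finite huniv hinter (hP.subset hsub) hsub)
  convert key
  ext y
  constructor
  · exact fun hy h => h _ ⟨y, hy, rfl⟩ fun S hS => hS.2
  · intro h
    obtain ⟨x, hx, hxy⟩ : ∃ x ∈ Y, y ∈ ⋂₀ {S ∈ P | x ∈ S} := by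
      by_contra! hne
      refine h ?_
      rintro _ ⟨x, hx, rfl⟩
      exact hne x hx
    refine hY x y (fun S hS => ⟨fun h => hxy S ⟨hS, h⟩, fun h => ?_⟩) hx
    by_contra hne
    exact hxy _ ⟨hcompl _ hS, hne⟩ h

section LexSum

variable {A : Type u} {B : Type v}

/-- The axiom $\Diamond_v p\to\Box_h\Diamond_v p$ carries vertical diamonds forward along horizontal
relations, and $\Diamond_h\Diamond_v p\to\Diamond_v p$ carries them back. -/
theorem Characterizes.mem_dia_inl_iff {X : Type w} {F : Frame (A ⊕ B) X} {θ : ℕ → Set X}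
    {L : Set (Formula (A ⊕ B))} (hL : IsLogic L) (hF : Characterizes F θ L)
    (hlex : lexAxioms A B ⊆ L) {a : A} {b : B} {x y : X} (hxy : F.rel (.inr b) x y)
    (φ : Formula (A ⊕ B)) :
    F.Sat θ x (dia (.inl a) φ) ↔ F.Sat θ y (dia (.inl a) φ) := by
  constructor
  · intro h
    have hmem := hL.substitution (fun _ => φ) _ (hlex ⟨a, b, Or.inr (Or.inr rfl)⟩)
    have := (hF _).1 hmem x h
    exact (F.sat_box θ x (.inr b) (dia (.inl a) φ)).1 this y hxy
  · intro h
    have hmem := hL.substitution (fun _ => φ) _ (hlex ⟨a, b, Or.inl rfl⟩)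
    exact (hF _).1 hmem x ⟨y, hxy, h⟩

/-- A logic containing the axioms of lexicographic sums is locally tabular if its vertical and
horizontal fragments are: every formula is equivalent to a vertical formula of horizontal formulas,
so canonicity plays no role. -/
theorem locallyTabular_of_lexAxioms {L : Set (Formula (A ⊕ B))} (hL : IsLogic L)
    (hlex : lexAxioms A B ⊆ L) (hA : LocallyTabular (pullback Sum.inl L))
    (hB : LocallyTabular (pullback Sum.inr L)) : LocallyTabular L := by
  obtain ⟨X, F, θ, hF⟩ := hL.exists_characterizes
  intro k
  have hQ := ((hF.pullback Sum.inr).kFinite_iff k).1 (hB k)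
  set Q := (F.comap Sum.inr).truthSet θ '' {φ : Formula B | φ.IsKFormula k} with hQdef
  obtain ⟨n, q, hq⟩ : ∃ (n : ℕ) (q : Fin n → Set X), Set.range q = Q := by
    have := hQ.to_subtype
    obtain ⟨n, ⟨e⟩⟩ := Finite.exists_equiv_fin Q
    exact ⟨n, fun i => (e.symm i).1, by
      rw [← Function.comp_def, Set.range_comp, e.symm.surjective.range_eq]; simp⟩
  have hβ : ∀ i : Fin n, ∃ β : Formula B, β.IsKFormula k ∧
      (F.comap Sum.inr).truthSet θ β = q i := fun i => by
    have : q i ∈ Q := hq ▸ ⟨i, rfl⟩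
    exact this
  choose β hβk hβq using hβ
  -- The value `bot` for `i ≥ n` is only a default: `P` is built from `n`-formulas.
  let s : ℕ → Formula (A ⊕ B) := fun i => if h : i < n then (β ⟨i, h⟩).map Sum.inr else bot
  let g : Formula A → Set X := fun α => F.truthSet θ ((α.map Sum.inl).subst s)
  have hgvar (i : Fin n) : g (var i) = q i := by
    have : ((var i : Formula A).map Sum.inl).subst s = (β i).map Sum.inr := by
      simp [Formula.map, subst, s]
    rw [← hβq]
    ext x
    simp only [g, this]
    exact F.sat_map Sum.inr θ x (β i)
  set P := g '' {α : Formula A | α.IsKFormula n} with hPdef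
  have hP : P.Finite := by
    -- Equivalent vertical formulas remain equivalent after the substitution `s`, so `P` is no
    -- larger than the vertical algebra on `n` variables.
    refine finite_image_of_imp (((hF.pullback Sum.inl).kFinite_iff n).1 (hA n))
      fun φ _ ψ _ h => ?_
    rw [← (hF.pullback Sum.inl).iff_mem] at h
    exact hF.iff_mem.1 (hL.substitution s _ h)
  have hPuniv : Set.univ ∈ P :=
    ⟨top, ⟨trivial, trivial⟩, Set.eq_univ_of_forall fun x h => h⟩
  have hPcompl : ∀ S ∈ P, Sᶜ ∈ P := by
    rintro _ ⟨α, hα, rfl⟩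
    exact ⟨neg α, ⟨hα, trivial⟩, rfl⟩
  have hPinter : ∀ S ∈ P, ∀ T ∈ P, S ∩ T ∈ P := by
    rintro _ ⟨α, hα, rfl⟩ _ ⟨α', hα', rfl⟩
    exact ⟨and α α', ⟨⟨hα, hα', trivial⟩, trivial⟩, Set.ext fun x => F.sat_and θ x _ _⟩
  have hQuniv : Set.univ ∈ Q :=
    ⟨top, ⟨trivial, trivial⟩, Set.eq_univ_of_forall fun x h => h⟩
  have hQcompl : ∀ S ∈ Q, Sᶜ ∈ Q := by
    rintro _ ⟨α, hα, rfl⟩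
    exact ⟨neg α, ⟨hα, trivial⟩, rfl⟩
  have hQinter : ∀ S ∈ Q, ∀ T ∈ Q, S ∩ T ∈ Q := by
    rintro _ ⟨α, hα, rfl⟩ _ ⟨α', hα', rfl⟩
    exact ⟨and α α', ⟨⟨hα, hα', trivial⟩, trivial⟩, Set.ext fun x => Frame.sat_and _ θ x _ _⟩
  have hQP : Q ⊆ P := by
    rw [← hq]
    rintro _ ⟨i, rfl⟩
    exact ⟨var i, i.2, hgvar i⟩
  -- Points are related if no vertical diamond formula and no horizontal formula separates them.
  let C : X → X → Prop := fun x y =>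
    ∀ (a : A) (α : Formula A), α.IsKFormula n → (x ∈ g (dia a α) ↔ y ∈ g (dia a α))
  let E : X → X → Prop := fun x y => ∀ S ∈ Q, x ∈ S ↔ y ∈ S
  have hPE : ∀ x y, C x y → E x y → ∀ S ∈ P, x ∈ S ↔ y ∈ S := by
    rintro x y hC hE _ ⟨α, hα, rfl⟩
    induction α with
    | var i =>
      have := hE (q ⟨i, hα⟩) (hq ▸ ⟨_, rfl⟩)
      rwa [← hgvar] at this
    | bot => exact Iff.rfl
    | imp φ ψ h₁ h₂ => exact imp_congr (h₁ hα.1) (h₂ hα.2)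
    | dia a φ _ => exact hC a φ hα
  have hrel (b : B) (x y : X) (h : F.rel (.inr b) x y) : C x y := fun a α _ =>
    hF.mem_dia_inl_iff hL hlex h _
  refine (hF.kFinite_iff k).2 (hP.subset ?_)
  rintro _ ⟨φ, hφ, rfl⟩
  induction φ with
  | var i => exact hQP ⟨var i, hφ, rfl⟩
  | bot => exact ⟨bot, trivial, rfl⟩
  | imp φ ψ h₁ h₂ =>
    obtain ⟨α, hα, h₁⟩ := h₁ hφ.1
    obtain ⟨α', hα', h₂⟩ := h₂ hφ.2
    refine ⟨imp α α', ⟨hα, hα'⟩, Set.ext fun x => ?_⟩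
    exact imp_congr (Set.ext_iff.1 h₁ x) (Set.ext_iff.1 h₂ x)
  | dia c φ ih =>
    have ih := ih hφ
    cases c with
    | inl a =>
      obtain ⟨α, hα, h⟩ := ih
      refine ⟨dia a α, hα, Set.ext fun x => ?_⟩
      exact exists_congr fun y => and_congr_right fun _ => Set.ext_iff.1 h y
    | inr b =>
      -- It suffices that points not separated by `P` agree on the diamond. A horizontal formula `γ`
      -- defines the `Q`-atom of `y`; since the truth set of `dia b γ` is in `Q ⊆ P`, some successor
      -- `y'` of `x'` lies in the same atom.
      refine mem_of_saturated hP hPuniv hPcompl hPinter fun x x' hxx' => ?_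
      rintro ⟨y, hxy, hy⟩
      have hatom : {z | E y z} ∈ Q :=
        mem_of_saturated hQ hQuniv hQcompl hQinter fun z z' hzz' hz S hS =>
          (hz S hS).trans (hzz' S hS)
      obtain ⟨γ, hγ, hγE⟩ := hatom
      have hdia : (F.comap Sum.inr).truthSet θ (dia b γ) ∈ Q := ⟨dia b γ, hγ, rfl⟩
      have hyγ : y ∈ (F.comap Sum.inr).truthSet θ γ := by
        rw [hγE]; exact fun S _ => Iff.rfl
      obtain ⟨y', hxy', hy'⟩ := (hxx' _ (hQP hdia)).1 ⟨y, hxy, hyγ⟩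
      have hE : E y y' := by
        have : y' ∈ (F.comap Sum.inr).truthSet θ γ := hy'
        rwa [hγE] at this
      -- Vertical diamonds transfer from `y` to `x` and from `x'` to `y'` along horizontal
      -- relations, and from `x` to `x'` because `P` does not separate these.
      have hC : C y y' := fun a α hα =>
        (hrel b x y hxy a α hα).symm.trans
          ((hxx' _ ⟨dia a α, hα, rfl⟩).trans (hrel b x' y' hxy' a α hα))
      exact ⟨y', hxy', (hPE y y' hC hE _ ih).1 hy⟩

end LexSum

end Modal

/-- An extension of `L₁ ⊕ L₂` contains `L₁`, `L₂` and the axioms of lexicographic sums, so the two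
criteria make its fragments locally tabular; the canonicity hypotheses are not needed. -/
theorem mainTheorem4 {A : Type*} {B : Type*} [Finite A] [Finite B]
    (L₁ : Set (Modal.Formula A)) (L₂ : Set (Modal.Formula B))
    (hL₁ : Modal.IsLogic L₁) (hL₂ : Modal.IsLogic L₂)
    (hc₁ : Modal.Canonical L₁) (hc₂ : Modal.Canonical L₂)
    (hf₁ : Modal.AdmitsFiniteHeightCriterion L₁)
    (hf₂ : Modal.AdmitsFiniteHeightCriterion L₂) :
    Modal.AdmitsFiniteHeightCriterion (Modal.lexSum L₁ L₂) := by
  intro L hL hsub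
  have hgen : Modal.Formula.map Sum.inl '' L₁ ∪ Modal.Formula.map Sum.inr '' L₂ ∪
      Modal.lexAxioms A B ⊆ L :=
    (Set.subset_sInter fun _ h => h.2).trans hsub
  -- `fragment L C` unfolds to the pullback of `L` along `Subtype.val`.
  refine ⟨fun h C => (h.pullback Subtype.val hL).height_lt_top (hL.pullback _), fun h => ?_⟩
  refine Modal.locallyTabular_of_lexAxioms hL (fun φ hφ => hgen (Or.inr hφ)) ?_ ?_
  · exact (hf₁ _ (hL.pullback _) fun φ hφ => hgen (Or.inl (Or.inl ⟨φ, hφ, rfl⟩))).2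
      fun C => Modal.height_fragment_pullback_lt_top hL C (h _)
  · exact (hf₂ _ (hL.pullback _) fun φ hφ => hgen (Or.inl (Or.inr ⟨φ, hφ, rfl⟩))).2
      fun C => Modal.height_fragment_pullback_lt_top hL C (h _)
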